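/- Let $\mathbb{F}_q$ denote the finite field with $q$ elements. An $[n,k,d]_q$ code is a $k$-dimensional linear subspace of $\mathbb{F}_q^n$ whose minimum Hamming distance is $d$. Put $$g_q(k,d)=\sum_{i=0}^{k-1}\left\lceil \frac{d}{q^i}\right\rceil,$$ the Griesmer lower bound on the length $n$ of an $[n,k,d]_q$ code. Then for every integer $k\ge 5$, every prime power $q\ge\max\{5,k-2\}$ and every integer $d$ with $$(k-2)q^{k-1}-5q^{k-2}+2q^{k-3}-q^2+q\;\le\; d\;\le\;(k-2)q^{k-1}-5q^{k-2}+2q^{k-3},$$ there exists a $[g_q(k,d),k,d]_q$ code, that is, a code attaining the Griesmer bound. -/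

import Mathlib

/-- `C` is an `[n, k, d]` code over the field `F`: an `F`-linear subspace of `F ^ n` of dimension
`k` whose minimum Hamming distance (between distinct codewords) is exactly `d`. -/
structure IsLinearCode {F : Type*} [Field F] [DecidableEq F] {n : ℕ}
    (C : Submodule F (Fin n → F)) (k d : ℕ) : Prop where
  finrank_eq : Module.finrank F C = k
  minDist_eq : IsLeast {w : ℕ | ∃ x ∈ C, ∃ y ∈ C, x ≠ y ∧ hammingDist x y = w} d

/-- The Griesmer bound `g_q(k, d) = ∑_{i = 0}^{k - 1} ⌈d / q ^ i⌉` (exact rational division,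
then the ceiling). -/
def griesmerBound (q k d : ℕ) : ℕ :=
  ∑ i ∈ Finset.range k, ⌈(d : ℚ) / (q : ℚ) ^ i⌉₊

/-!
A code of length `n` and dimension `k` is a multiset of `n` points of a projective space
`PG(V)`, `dim V = k`; its minimum distance is at least `d` if every hyperplane misses at least `d`
of them. With `r = k - 3` the upper end of the range is
`d = (r + 1) q ^ (r + 2) - 4 q ^ (r + 1) - (q - 2) q ^ r`, and the Griesmer bound of such a `d` is
read off from its base-`q` expansion (`le_griesmerBound_of_digits`): it is the size one gets by
taking `r + 1` copies of `PG(V)` and removing four hyperplanes and `q - 2` subspaces of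
codimension two. A hyperplane meets each removed subspace in at least the expected number of
points, so the distance is right as well; what has to be arranged is that no point is removed more
than `r + 1` times. For `k = 5` four hyperplanes always have a common point, so honest subspaces
are not enough.

Write `V = F ⊕ F ⊕ W`, with `W` the polynomials `w` of degree at most `r`, and a vector as
`(a, b, w)`. The multiset removed is `a = 0` plus `b = 0` minus their intersection `a = b = 0`, plus
`w(0) = 0`, plus `w(∞) = 0` (vanishing of the coefficient of degree `r`), plus, for each
`x ∈ Fˣ`, the codimension-two subspace `b = x a`, `w(x) = 0`. There are `q - 1` of the latter and
one codimension-two subspace is given back, so the size is right. Giving back `a = b = 0` could only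
hurt hyperplanes through it; but such a hyperplane contains `a = 0`, `b = 0`, or one of the
subspaces `b = x a`, `w(x) = 0`, and this compensates the loss (`exists_ker_of_axis_le`,
`sumWhere_baseMult_le`). On `a = b = 0` the multiplicity is one more than the number of zeros of
`w` on `F ∪ {∞}`, so at most `r + 1`; elsewhere it is at most `3` (`baseMult_le`).

The remaining defect `e ≤ q ^ 2 - q` is written `e = e₁ q + e₀`: one removes `e₁` further lines
and `e₀` further points of another line. The lines are the `q - 1` pairwise disjoint lines
`w = l (a + b X ^ r)`, `l ∈ Fˣ`, at whose points the multiplicity so far is at most `2`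
(`baseMult_le_two`).

That the distance is exactly `d`, not larger, is obtained by blanking coordinates one at a time:
each step lowers the minimum distance by at most one (`exists_isLinearCode_of_le_card`).
-/

open Module

/-! ### Codes from multisets of projective points -/

/-- A family of at most `n` vectors such that every nonzero functional is nonzero on at least `d`
of them gives a code of length `n` with minimum distance exactly `d`: coordinates are dropped while
all weights stay at least `d`, and the code is then padded by zeros. -/
theorem exists_isLinearCode_of_le_card {F V ι : Type*} [Field F] [DecidableEq F]
    [AddCommGroup V] [Module F V] [FiniteDimensional F V] [Fintype ι] (g : ι → V) {n d : ℕ}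
    (hn : Fintype.card ι ≤ n) (hd : 0 < d) (hV : 0 < finrank F V)
    (h : ∀ f : Dual F V, f ≠ 0 → d ≤ (Finset.univ.filter fun i => f (g i) ≠ 0).card) :
    ∃ C : Submodule F (Fin n → F), IsLinearCode C (finrank F V) d := by
  classical
  -- A minimal set `J` of coordinates on which all weights are still at least `d`.
  obtain ⟨J, hJ, hmin⟩ := Finset.exists_min_image
    ((Finset.univ : Finset (Finset ι)).filter fun J =>
      ∀ f : Dual F V, f ≠ 0 → d ≤ (J.filter fun i => f (g i) ≠ 0).card)
    Finset.card ⟨Finset.univ, by simpa using h⟩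
  simp only [Finset.mem_filter, Finset.mem_univ, true_and] at hJ hmin
  obtain ⟨f₀, hf₀, hf₀d⟩ : ∃ f : Dual F V, f ≠ 0 ∧
      (J.filter fun i => f (g i) ≠ 0).card = d := by
    by_contra! hne
    have : Nontrivial (Dual F V) :=
      Module.nontrivial_of_finrank_pos (R := F) (by rwa [Subspace.dual_finrank_eq])
    obtain ⟨f, hf⟩ := exists_ne (0 : Dual F V)
    obtain ⟨j, hj⟩ : J.Nonempty := by
      obtain ⟨j, hj⟩ := Finset.card_pos.1 (hd.trans_le (hJ f hf))
      exact ⟨j, (Finset.mem_filter.1 hj).1⟩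
    -- If every weight exceeds `d`, then `j` can be dropped, against minimality.
    have := hmin (J.erase j) fun f' hf' => by
      have h1 := lt_of_le_of_ne (hJ f' hf') (hne f' hf').symm
      rw [Finset.filter_erase]
      have := Finset.pred_card_le_card_erase (s := J.filter fun i => f' (g i) ≠ 0) (a := j)
      omega
    rw [Finset.card_erase_of_mem hj] at this
    have := Finset.card_pos.2 ⟨j, hj⟩
    omega
  obtain ⟨e⟩ : Nonempty (J ↪ Fin n) :=
    Function.Embedding.nonempty_of_card_le (by simpa using (Finset.card_le_univ J).trans hn)
  let φ : Dual F V →ₗ[F] (Fin n → F) :=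
    Function.ExtendByZero.linearMap F e ∘ₗ LinearMap.pi fun i : J => Dual.eval F V (g i)
  have hφe (f : Dual F V) (i : J) : φ f (e i) = f (g i) :=
    e.injective.extend_apply (fun i : J => f (g i)) 0 i
  have hφ0 (f : Dual F V) (j : Fin n) (hj : ¬∃ i, e i = j) : φ f j = 0 :=
    Function.extend_apply' (fun i : J => f (g i)) (0 : Fin n → F) j hj
  have hnorm (f : Dual F V) : hammingNorm (φ f) = (J.filter fun i => f (g i) ≠ 0).card := by
    refine (Finset.card_bij (fun i hi => e ⟨i, (Finset.mem_filter.1 hi).1⟩) ?_ ?_ ?_).symm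
    · intro i hi
      simpa [hφe] using (Finset.mem_filter.1 hi).2
    · intro i _ i' _ hii'
      exact congrArg Subtype.val (e.injective hii')
    · intro j hj
      by_cases hj' : ∃ i, e i = j
      · obtain ⟨i, rfl⟩ := hj'
        exact ⟨i, by simpa [hφe] using hj, rfl⟩
      · exact absurd (hφ0 f j hj') (by simpa using hj)
  have hinj : Function.Injective φ := by
    refine (injective_iff_map_eq_zero φ).2 fun f hf => ?_
    by_contra hne
    have := hJ f hne
    rw [← hnorm, hf, hammingNorm_zero] at this
    omega
  refine ⟨LinearMap.range φ, ?_, ?_, ?_⟩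
  · rw [LinearMap.finrank_range_of_inj hinj, Subspace.dual_finrank_eq]
  · refine ⟨φ f₀, ⟨f₀, rfl⟩, 0, zero_mem _, ?_, ?_⟩
    · rw [← map_zero φ]
      exact fun h => hf₀ (hinj h)
    · rw [hammingDist_zero_right, hnorm, hf₀d]
  · rintro w ⟨_, ⟨f, rfl⟩, _, ⟨f', rfl⟩, hne, rfl⟩
    rw [hammingDist_eq_hammingNorm, neg_add_eq_sub, ← map_sub, hnorm]
    refine hJ _ fun h => hne ?_
    rw [sub_eq_zero.1 h]

/-- A function constant on punctured lines through `0` sums over the nonzero vectors to `q - 1`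
times its sum over the projective points. -/
theorem Projectivization.sum_ne_zero_eq {F V : Type*} [Field F] [Fintype F]
    [AddCommGroup V] [Module F V] [Fintype V] [DecidableEq V] [Fintype (Projectivization F V)]
    (μ : V → ℤ) (hμ : ∀ (c : F) (v : V), c ≠ 0 → μ (c • v) = μ v) :
    ∑ v with v ≠ 0, μ v = ((Fintype.card F : ℤ) - 1) * ∑ p : Projectivization F V, μ p.rep := by
  classical
  let φ : Projectivization F V × Fˣ → V := fun x => (x.2 : F) • x.1.rep
  have h1 : ∑ x : Projectivization F V × Fˣ, μ (φ x) = ∑ v with v ≠ 0, μ v := by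
    refine Finset.sum_bij (fun x _ => φ x) ?_ ?_ ?_ (fun _ _ => rfl)
    · intro x _
      simp [φ, x.1.rep_nonzero]
    · rintro ⟨p, c⟩ _ ⟨p', c'⟩ _ h
      have hp : p = p' := by
        rw [← p.mk_rep, ← p'.mk_rep, Projectivization.mk_eq_mk_iff']
        refine ⟨(c : F)⁻¹ * c', ?_⟩
        rw [mul_smul, ← show (c : F) • p.rep = (c' : F) • p'.rep from h, smul_smul]
        simp
      subst hp
      have hc := smul_left_injective F p.rep_nonzero h
      exact congrArg _ (Units.ext hc)
    · intro v hv
      obtain ⟨c, hc⟩ := Projectivization.exists_smul_eq_mk_rep F v (by simpa using hv)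
      refine ⟨(Projectivization.mk F v (by simpa using hv), c⁻¹), Finset.mem_univ _, ?_⟩
      simp only [φ, ← hc, ← Units.smul_def, inv_smul_smul]
  rw [← h1, Fintype.sum_prod_type, Finset.mul_sum]
  refine Finset.sum_congr rfl fun p _ => ?_
  rw [Finset.sum_congr rfl fun (c : Fˣ) _ => hμ c p.rep c.ne_zero]
  have := Fintype.card_units (α := F)
  have h0 : 0 < Fintype.card F := Fintype.card_pos
  simp [this, Nat.cast_sub (Nat.one_le_of_lt h0)]

/-- A multiset of projective points, given by a multiplicity function `μ` on vectors, gives a code.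
Its size and the number of its points off a hyperplane are counted over vectors, hence the factors
`q - 1`. The value `μ 0` is irrelevant. -/
theorem exists_isLinearCode_of_multiplicity {F V : Type*} [Field F] [Fintype F] [DecidableEq F]
    [AddCommGroup V] [Module F V] [Fintype V] [DecidableEq V] (μ : V → ℤ)
    (hμ : ∀ (c : F) (v : V), c ≠ 0 → μ (c • v) = μ v) (hμ0 : ∀ v ≠ 0, 0 ≤ μ v)
    {n d : ℕ} (hd : 0 < d) (hV : 0 < finrank F V)
    (hn : ∑ v with v ≠ 0, μ v ≤ ((Fintype.card F : ℤ) - 1) * n)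
    (h : ∀ f : Dual F V, f ≠ 0 → ((Fintype.card F : ℤ) - 1) * d ≤ ∑ v with f v ≠ 0, μ v) :
    ∃ C : Submodule F (Fin n → F), IsLinearCode C (finrank F V) d := by
  classical
  have : Fintype (Projectivization F V) := Fintype.ofFinite _
  have hq : (0 : ℤ) < (Fintype.card F : ℤ) - 1 := by
    have := Fintype.one_lt_card (α := F)
    omega
  have hrep (p : Projectivization F V) : ((μ p.rep).toNat : ℤ) = μ p.rep :=
    Int.toNat_of_nonneg (hμ0 _ p.rep_nonzero)
  refine exists_isLinearCode_of_le_card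
    (ι := Σ p : Projectivization F V, Fin (μ p.rep).toNat) (fun i => i.1.rep) ?_ hd hV ?_
  · rw [Projectivization.sum_ne_zero_eq μ hμ] at hn
    have := le_of_mul_le_mul_left hn hq
    zify
    simpa [hrep] using this
  · intro f hf
    have h1 := h f hf
    -- A vector off the kernel of `f` is automatically nonzero.
    have h2 : ∑ v with f v ≠ 0, μ v = ∑ v with v ≠ 0, if f v ≠ 0 then μ v else 0 := by
      rw [← Finset.sum_filter, Finset.filter_filter]
      refine Finset.sum_congr (Finset.filter_congr fun v _ => ?_) fun _ _ => rfl
      refine ⟨fun hv => ⟨?_, hv⟩, fun hv => hv.2⟩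
      rintro rfl
      exact hv (map_zero f)
    rw [h2, Projectivization.sum_ne_zero_eq (F := F) _ fun c v hc => by simp [hc, hμ]] at h1
    have h3 := le_of_mul_le_mul_left h1 hq
    zify
    rw [Finset.card_filter, Fintype.sum_sigma]
    refine h3.trans_eq ?_
    push_cast
    refine Finset.sum_congr rfl fun p _ => ?_
    by_cases hp : f p.rep = 0 <;> simp [hp, hrep]

/-! ### Counting vectors of a subspace off a hyperplane -/

/-- The indicator function of a subspace, with values in `ℤ` so that multisets of points can be
added and subtracted. -/
noncomputable def subspaceInd {F V : Type*} [Field F] [AddCommGroup V] [Module F V]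
    (S : Submodule F V) : V → ℤ :=
  (S : Set V).indicator 1

/-- Summation of an integer-valued function over the vectors satisfying `p`, as an additive map. -/
noncomputable def sumWhere {V : Type*} [Fintype V] (p : V → Prop) : (V → ℤ) →+ ℤ where
  toFun μ := open Classical in ∑ v with p v, μ v
  map_zero' := by simp
  map_add' _ _ := by simp [Finset.sum_add_distrib]

theorem sumWhere_apply {V : Type*} [Fintype V] (p : V → Prop) [DecidablePred p] (μ : V → ℤ) :
    sumWhere p μ = ∑ v with p v, μ v := by
  simp only [sumWhere, AddMonoidHom.coe_mk, ZeroHom.coe_mk]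
  congr

section
variable {F V : Type*} [Field F] [AddCommGroup V] [Module F V]

theorem subspaceInd_of_mem {S : Submodule F V} {v : V} (h : v ∈ S) : subspaceInd S v = 1 :=
  Set.indicator_of_mem (s := (S : Set V)) h 1

theorem subspaceInd_of_notMem {S : Submodule F V} {v : V} (h : v ∉ S) : subspaceInd S v = 0 :=
  Set.indicator_of_notMem (s := (S : Set V)) h 1

theorem subspaceInd_eq_ite (S : Submodule F V) (v : V) [Decidable (v ∈ S)] :
    subspaceInd S v = if v ∈ S then 1 else 0 := by
  split_ifs with h
  · exact subspaceInd_of_mem h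
  · exact subspaceInd_of_notMem h

theorem subspaceInd_smul (S : Submodule F V) {c : F} (hc : c ≠ 0) (v : V) :
    subspaceInd S (c • v) = subspaceInd S v := by
  classical
  simp only [subspaceInd_eq_ite, S.smul_mem_iff hc]

theorem sumWhere_ne_zero_subspaceInd [Fintype V] (S : Submodule F V) :
    sumWhere (fun v : V => v ≠ 0) (subspaceInd S) = Nat.card S - 1 := by
  classical
  have h : ∑ v : V, subspaceInd S v = Nat.card S := by
    simp [subspaceInd_eq_ite, Nat.card_eq_fintype_card, Fintype.card_subtype]
  rw [← h, ← Finset.sum_erase_add _ _ (Finset.mem_univ (0 : V)),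
    subspaceInd_of_mem (zero_mem S), add_sub_cancel_right]
  rw [sumWhere_apply, Finset.filter_ne']

theorem sumWhere_subspaceInd_of_le_ker [Fintype V] {S : Submodule F V} {f : Dual F V}
    (h : S ≤ LinearMap.ker f) : sumWhere (fun v => f v ≠ 0) (subspaceInd S) = 0 := by
  classical
  rw [sumWhere_apply]
  refine Finset.sum_eq_zero fun v hv => subspaceInd_of_notMem fun hS => ?_
  exact (Finset.mem_filter.1 hv).2 (h hS)

theorem sum_subspaceInd_le_one {ι : Type*} (s : Finset ι) (S : ι → Submodule F V) (v : V)
    (h : ∀ i ∈ s, ∀ j ∈ s, v ∈ S i → v ∈ S j → i = j) : ∑ i ∈ s, subspaceInd (S i) v ≤ 1 := by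
  classical
  simp only [subspaceInd_eq_ite, Finset.sum_boole]
  exact_mod_cast Finset.card_le_one.2 fun i hi j hj =>
    h i (Finset.mem_filter.1 hi).1 j (Finset.mem_filter.1 hj).1 (Finset.mem_filter.1 hi).2
      (Finset.mem_filter.1 hj).2

variable [Fintype F] [Fintype V]

theorem sumWhere_subspaceInd_of_not_le_ker {S : Submodule F V} {f : Dual F V} {j : ℕ}
    (hS : Nat.card S = Fintype.card F ^ (j + 1)) (h : ¬S ≤ LinearMap.ker f) :
    sumWhere (fun v => f v ≠ 0) (subspaceInd S) =
      (Fintype.card F : ℤ) ^ (j + 1) - (Fintype.card F : ℤ) ^ j := by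
  classical
  have hsurj : Function.Surjective (f.domRestrict S) := by
    refine LinearMap.surjective fun h0 => h fun v hv => ?_
    exact LinearMap.congr_fun h0 ⟨v, hv⟩
  have h1 : Nat.card (LinearMap.ker (f.domRestrict S)) * Fintype.card F = Nat.card S := by
    rw [Submodule.card_eq_card_quotient_mul_card (LinearMap.ker (f.domRestrict S)),
      Nat.card_congr ((f.domRestrict S).quotKerEquivOfSurjective hsurj).toEquiv,
      Nat.card_eq_fintype_card (α := F)]
  have hker : Nat.card (LinearMap.ker (f.domRestrict S)) = Fintype.card F ^ j := by
    rw [hS, pow_succ] at h1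
    exact Nat.eq_of_mul_eq_mul_right Fintype.card_pos h1
  have h2 : sumWhere (fun v => f v ≠ 0) (subspaceInd S) +
      sumWhere (fun v => f v = 0) (subspaceInd S) = Nat.card S := by
    rw [sumWhere_apply, sumWhere_apply, add_comm, Finset.sum_filter_add_sum_filter_not]
    simp [subspaceInd_eq_ite, Nat.card_eq_fintype_card, Fintype.card_subtype]
  have h3 : sumWhere (fun v => f v = 0) (subspaceInd S) =
      Nat.card (LinearMap.ker (f.domRestrict S)) := by
    have e : LinearMap.ker (f.domRestrict S) ≃ {v : V // f v = 0 ∧ v ∈ S} :=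
      { toFun := fun v => ⟨v.1.1, v.2, v.1.2⟩
        invFun := fun v => ⟨⟨v.1, v.2.2⟩, v.2.1⟩
        left_inv := fun _ => rfl
        right_inv := fun _ => rfl }
    rw [Nat.card_congr e, Nat.card_eq_fintype_card, Fintype.card_subtype, sumWhere_apply]
    simp [subspaceInd_eq_ite, Finset.filter_filter]
  rw [h3, hker, hS] at h2
  push_cast at h2
  linarith

/-- A subspace of dimension `j + 1` has at most `q ^ (j + 1) - q ^ j` vectors off a hyperplane. -/
theorem sumWhere_subspaceInd_le {S : Submodule F V} (f : Dual F V) {j : ℕ}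
    (hS : Nat.card S = Fintype.card F ^ (j + 1)) :
    sumWhere (fun v => f v ≠ 0) (subspaceInd S) ≤
      (Fintype.card F : ℤ) ^ (j + 1) - (Fintype.card F : ℤ) ^ j := by
  by_cases h : S ≤ LinearMap.ker f
  · rw [sumWhere_subspaceInd_of_le_ker h, sub_nonneg]
    exact pow_le_pow_right₀ (by exact_mod_cast Fintype.card_pos) (Nat.le_succ j)
  · exact (sumWhere_subspaceInd_of_not_le_ker hS h).le

end

/-! ### The Griesmer bound from a base-`q` expansion -/

theorem sum_digits_lt_pow {q : ℕ} (ε : ℕ → ℕ) (hε : ∀ j, ε j < q) (i : ℕ) :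
    ∑ j ∈ Finset.range i, ε j * q ^ j < q ^ i := by
  induction i with
  | zero => simp
  | succ i ih =>
    rw [Finset.sum_range_succ, pow_succ']
    nlinarith [Nat.mul_le_mul_right (q ^ i) (Nat.succ_le_of_lt (hε i))]

/-- If `d = s q ^ K - ∑ ε_j q ^ j` with base-`q` digits `ε_j`, then
`g_q(K + 1, d) ≥ s (q ^ (K + 1) - 1) / (q - 1) - ∑ ε_j (q ^ (j + 1) - 1) / (q - 1)`,
stated with the denominator `q - 1` cleared. -/
theorem le_griesmerBound_of_digits {q d s K : ℕ} (ε : ℕ → ℕ) (hq : 0 < q) (hε : ∀ j, ε j < q)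
    (h : d + ∑ j ∈ Finset.range K, ε j * q ^ j = s * q ^ K) :
    (s : ℤ) * ((q : ℤ) ^ (K + 1) - 1) - ∑ j ∈ Finset.range K, (ε j : ℤ) * ((q : ℤ) ^ (j + 1) - 1) ≤
      ((q : ℤ) - 1) * griesmerBound q (K + 1) d := by
  -- In `⌈d / q ^ i⌉` the digits below position `i` contribute less than one and round away.
  have key (i : ℕ) (hi : i ∈ Finset.range (K + 1)) :
      s * q ^ (K - i) ≤ ⌈(d : ℚ) / (q : ℚ) ^ i⌉₊ + ∑ j ∈ Finset.Ico i K, ε j * q ^ (j - i) := by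
    have hi' : i ≤ K := Nat.lt_succ_iff.1 (Finset.mem_range.1 hi)
    have h1 := Finset.sum_range_add_sum_Ico (fun j => ε j * q ^ j) hi'
    have h2 : ∑ j ∈ Finset.Ico i K, ε j * q ^ j =
        (∑ j ∈ Finset.Ico i K, ε j * q ^ (j - i)) * q ^ i := by
      rw [Finset.sum_mul]
      refine Finset.sum_congr rfl fun j hj => ?_
      rw [mul_assoc, ← pow_add, Nat.sub_add_cancel (Finset.mem_Ico.1 hj).1]
    have h3 := sum_digits_lt_pow ε hε i
    have h4 : d ≤ ⌈(d : ℚ) / (q : ℚ) ^ i⌉₊ * q ^ i := by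
      have := Nat.le_ceil ((d : ℚ) / (q : ℚ) ^ i)
      rw [div_le_iff₀ (by positivity)] at this
      exact_mod_cast this
    have h5 : s * q ^ K = s * q ^ (K - i) * q ^ i := by
      rw [mul_assoc, ← pow_add, Nat.sub_add_cancel hi']
    refine Nat.lt_succ_iff.1 (lt_of_mul_lt_mul_right (a := q ^ i) ?_ (Nat.zero_le _))
    rw [← h5, Nat.succ_mul, add_mul, ← h2]
    omega
  have hsum := Finset.sum_le_sum key
  rw [Finset.sum_add_distrib, ← griesmerBound, ← Finset.mul_sum] at hsum
  have hg (n : ℕ) : ((q : ℤ) - 1) * ∑ i ∈ Finset.range n, (q : ℤ) ^ i = (q : ℤ) ^ n - 1 := by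
    rw [mul_comm, geom_sum_mul]
  have hL : ∑ i ∈ Finset.range (K + 1), q ^ (K - i) = ∑ i ∈ Finset.range (K + 1), q ^ i := by
    simpa using Finset.sum_range_reflect (fun i => q ^ i) (K + 1)
  have hR : ∑ i ∈ Finset.range (K + 1), ∑ j ∈ Finset.Ico i K, ε j * q ^ (j - i) =
      ∑ j ∈ Finset.range K, ε j * ∑ i ∈ Finset.range (j + 1), q ^ i := by
    rw [Finset.sum_comm' (t' := Finset.range K) (s' := fun j => Finset.range (j + 1))]
    · refine Finset.sum_congr rfl fun j _ => ?_
      rw [← Finset.mul_sum]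
      congr 1
      simpa using Finset.sum_range_reflect (fun i => q ^ i) (j + 1)
    · intro i j
      simp only [Finset.mem_range, Finset.mem_Ico]
      omega
  rw [hL, hR] at hsum
  zify at hsum
  have hq1 : (0 : ℤ) ≤ (q : ℤ) - 1 := by omega
  have := mul_le_mul_of_nonneg_left hsum hq1
  rw [mul_add, mul_left_comm, hg, Finset.mul_sum] at this
  simp_rw [mul_left_comm _ (ε _ : ℤ), hg] at this
  linarith

/-- The digits of the base-`q` expansion of `4 q ^ (r + 1) + (q - 2) q ^ r + e`, for `2 ≤ r` and
`e < q ^ 2`. -/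
def defectDigit (q r e j : ℕ) : ℕ :=
  if j = r + 1 then 4 else if j = r then q - 2 else if j = 1 then e / q else
    if j = 0 then e % q else 0

theorem defectDigit_lt {q r e : ℕ} (hq : 5 ≤ q) (he : e ≤ q ^ 2 - q) (j : ℕ) :
    defectDigit q r e j < q := by
  have h1 : e / q < q := by
    refine Nat.div_lt_of_lt_mul ?_
    have : 0 < q ^ 2 := by positivity
    rw [← sq]
    omega
  have h2 : e % q < q := Nat.mod_lt _ (by omega)
  unfold defectDigit
  split_ifs <;> omega

theorem sum_defectDigit_mul {q r e : ℕ} (hr : 2 ≤ r) {R : Type*} [CommSemiring R] (h : ℕ → R) :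
    ∑ j ∈ Finset.range (r + 2), (defectDigit q r e j : R) * h j =
      4 * h (r + 1) + (q - 2 : ℕ) * h r + (e / q : ℕ) * h 1 + (e % q : ℕ) * h 0 := by
  obtain ⟨m, rfl⟩ := Nat.exists_eq_add_of_le' hr
  rw [Finset.sum_range_succ, Finset.sum_range_succ, Finset.sum_range_succ', Finset.sum_range_succ',
    Finset.sum_eq_zero]
  · simp [defectDigit]
    ring
  · intro j hj
    have : j < m := Finset.mem_range.1 hj
    simp [defectDigit, this.ne, (this.trans (Nat.lt_succ_self m)).ne]

/-! ### The subspaces removed and their multiplicities -/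

section
variable {F : Type*} [Field F]

/-- The space `F ⊕ F ⊕ W` of triples `(a, b, w)`, where `w` is the coefficient vector of a
polynomial of degree at most `r`. -/
abbrev PencilSpace (F : Type*) (r : ℕ) : Type _ := F × F × (Fin (r + 1) → F)

variable {r : ℕ}

/-- The linear form `(a, b, w) ↦ a`. -/
def fstForm : PencilSpace F r →ₗ[F] F := LinearMap.fst F F _

/-- The linear form `(a, b, w) ↦ b`. -/
def sndForm : PencilSpace F r →ₗ[F] F := LinearMap.fst F F _ ∘ₗ LinearMap.snd F F _

/-- The linear form taking `(a, b, w)` to the coefficient of degree `i` of `w`. -/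
def coordForm (i : Fin (r + 1)) : PencilSpace F r →ₗ[F] F :=
  LinearMap.proj i ∘ₗ LinearMap.snd F F _ ∘ₗ LinearMap.snd F F _

/-- The subspace `a = b = 0`. -/
def axis (F : Type*) [Field F] (r : ℕ) : Submodule F (PencilSpace F r) :=
  LinearMap.ker (fstForm.prod sndForm)

/-- The map `(a, b) ↦ (a, b, l (a + b X ^ r))`. -/
def rulingMap (r : ℕ) (l : F) : F × F →ₗ[F] PencilSpace F r :=
  (LinearMap.fst F F F).prod ((LinearMap.snd F F F).prod
    (l • (LinearMap.single F (fun _ => F) 0 ∘ₗ LinearMap.fst F F F +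
      LinearMap.single F (fun _ => F) (Fin.last r) ∘ₗ LinearMap.snd F F F)))

/-- The line `w = l (a + b X ^ r)`; these lines are one ruling of a hyperbolic quadric. -/
def ruling (r : ℕ) (l : F) : Submodule F (PencilSpace F r) := LinearMap.range (rulingMap r l)

/-- The projective point of the line `ruling r l` with `(a : b) = (1 : y)`. -/
def rulingPoint (r : ℕ) (l y : F) : Submodule F (PencilSpace F r) :=
  Submodule.span F {rulingMap r l (1, y)}

theorem mem_axis {v : PencilSpace F r} : v ∈ axis F r ↔ v.1 = 0 ∧ v.2.1 = 0 := by
  simp [axis, fstForm, sndForm]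

theorem mem_ker_fstForm {v : PencilSpace F r} : v ∈ LinearMap.ker fstForm ↔ v.1 = 0 := Iff.rfl

theorem mem_ker_sndForm {v : PencilSpace F r} : v ∈ LinearMap.ker sndForm ↔ v.2.1 = 0 := Iff.rfl

theorem mem_ker_coordForm {v : PencilSpace F r} {i : Fin (r + 1)} :
    v ∈ LinearMap.ker (coordForm i) ↔ v.2.2 i = 0 := Iff.rfl

theorem mem_ruling {l : F} {v : PencilSpace F r} :
    v ∈ ruling r l ↔ v.2.2 = l • (Pi.single 0 v.1 + Pi.single (Fin.last r) v.2.1) := by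
  constructor
  · rintro ⟨⟨a, b⟩, rfl⟩
    rfl
  · intro h
    exact ⟨(v.1, v.2.1), Prod.ext rfl (Prod.ext rfl h.symm)⟩

theorem ruling_coords (hr : 2 ≤ r) {l : F} {v : PencilSpace F r} (h : v ∈ ruling r l) :
    v.2.2 0 = l * v.1 ∧ v.2.2 (Fin.last r) = l * v.2.1 := by
  have h0 : (0 : Fin (r + 1)) ≠ Fin.last r := by
    intro h
    have := congrArg Fin.val h
    simp at this
    omega
  rw [mem_ruling.1 h]
  simp [h0, h0.symm]

theorem not_axis_of_mem_ruling {l : F} {v : PencilSpace F r} (hv : v ≠ 0) (h : v ∈ ruling r l) :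
    ¬(v.1 = 0 ∧ v.2.1 = 0) := by
  rintro ⟨h1, h2⟩
  refine hv (Prod.ext h1 (Prod.ext h2 ?_))
  rw [mem_ruling.1 h, h1, h2]
  simp

theorem ruling_inj (hr : 2 ≤ r) {l l' : F} {v : PencilSpace F r} (hv : v ≠ 0)
    (h : v ∈ ruling r l) (h' : v ∈ ruling r l') : l = l' := by
  have h1 := ruling_coords hr h
  have h2 := ruling_coords hr h'
  by_cases ha : v.1 = 0
  · have hb : v.2.1 ≠ 0 := fun hb => not_axis_of_mem_ruling hv h ⟨ha, hb⟩
    exact mul_right_cancel₀ hb (h1.2.symm.trans h2.2)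
  · exact mul_right_cancel₀ ha (h1.1.symm.trans h2.1)

theorem rulingPoint_le (l y : F) : rulingPoint r l y ≤ ruling r l := by
  rw [rulingPoint, Submodule.span_singleton_le_iff_mem]
  exact ⟨_, rfl⟩

theorem rulingPoint_inj {l y y' : F} {v : PencilSpace F r} (hv : v ≠ 0)
    (h : v ∈ rulingPoint r l y) (h' : v ∈ rulingPoint r l y') : y = y' := by
  obtain ⟨c, rfl⟩ := Submodule.mem_span_singleton.1 h
  obtain ⟨c', hc'⟩ := Submodule.mem_span_singleton.1 h'
  have hc : c ≠ 0 := by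
    rintro rfl
    simp at hv
  have h1 : c' = c := by simpa [rulingMap] using congrArg Prod.fst hc'
  have h2 : c' * y' = c * y := by simpa [rulingMap] using congrArg (fun v => v.2.1) hc'
  rw [h1] at h2
  exact (mul_left_cancel₀ hc h2).symm

/-- The multiplicities of the lines `ruling r l`, `l ∈ Λ`, together with the points of
`ruling r l₀` indexed by `T`. -/
noncomputable def removalMult (r : ℕ) (Λ : Finset Fˣ) (l₀ : Fˣ) (T : Finset F) :
    PencilSpace F r → ℤ :=
  ∑ l ∈ Λ, subspaceInd (ruling r (l : F)) + ∑ y ∈ T, subspaceInd (rulingPoint r (l₀ : F) y)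

variable [DecidableEq F]

/-- Evaluation at `x` of the polynomial with coefficient vector `w`. -/
noncomputable def polyEval (x : F) : (Fin (r + 1) → F) →ₗ[F] F :=
  Polynomial.leval x ∘ₗ Polynomial.ofFn (r + 1)

/-- The codimension-two subspace `b = x a`, `w(x) = 0`. -/
noncomputable def evalSubspace (r : ℕ) (x : Fˣ) : Submodule F (PencilSpace F r) :=
  LinearMap.ker (LinearMap.prod (sndForm - (x : F) • fstForm)
    (polyEval (x : F) ∘ₗ LinearMap.snd F F _ ∘ₗ LinearMap.snd F F _))

/-- A nonzero polynomial of degree at most `r` has at most `r` zeros in `F ∪ {∞}`, the zero at `∞`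
being the vanishing of the coefficient of degree `r`. -/
theorem card_zeros_add_le (w : Fin (r + 1) → F) (hw : w ≠ 0) [Fintype F] :
    (if w 0 = 0 then 1 else 0) + (if w (Fin.last r) = 0 then 1 else 0) +
      (Finset.univ.filter fun x : Fˣ => polyEval (x : F) w = 0).card ≤ r := by
  set p := Polynomial.ofFn (r + 1) w with hp
  have hp0 : p ≠ 0 := fun h => hw (Polynomial.injective_ofFn (r + 1) (by simpa [hp] using h))
  have hdeg : p.natDegree < r + 1 := Polynomial.ofFn_natDegree_lt (by omega) w
  have h1 : (if w 0 = 0 then 1 else 0) +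
      (Finset.univ.filter fun x : Fˣ => polyEval (x : F) w = 0).card ≤ p.natDegree := by
    refine le_trans ?_ (p.card_roots')
    refine le_trans ?_ (Multiset.toFinset_card_le _)
    let A : Finset F := if w 0 = 0 then {0} else ∅
    let B : Finset F := (Finset.univ.filter fun x : Fˣ => polyEval (x : F) w = 0).map
      ⟨Units.val, Units.val_injective⟩
    have hAB : Disjoint A B := by
      rw [Finset.disjoint_left]
      intro x hx
      have : x = 0 := by
        by_contra h
        by_cases h0 : w 0 = 0 <;> simp [A, h0, h] at hx
      simp [B, this]
    have hA : A.card = if w 0 = 0 then 1 else 0 := by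
      by_cases h0 : w 0 = 0 <;> simp [A, h0]
    have hsub : A ∪ B ⊆ p.roots.toFinset := by
      intro x hx
      rw [Multiset.mem_toFinset, Polynomial.mem_roots hp0, Polynomial.IsRoot.def]
      rcases Finset.mem_union.1 hx with hx | hx
      · by_cases h0 : w 0 = 0
        · have : x = 0 := by simpa [A, h0] using hx
          rw [this, ← Polynomial.coeff_zero_eq_eval_zero, hp,
            Polynomial.ofFn_coeff_eq_val_of_lt w (Nat.succ_pos r)]
          exact h0
        · simp [A, h0] at hx
      · obtain ⟨u, hu, rfl⟩ := Finset.mem_map.1 hx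
        exact (Finset.mem_filter.1 hu).2
    rw [← hA, ← Finset.card_map ⟨Units.val, Units.val_injective⟩,
      ← Finset.card_union_of_disjoint hAB]
    exact Finset.card_le_card hsub
  have h2 : (if w (Fin.last r) = 0 then 1 else 0) + p.natDegree ≤ r := by
    split_ifs with h
    · have hne : p.natDegree ≠ r := by
        intro hr
        have h3 := Polynomial.leadingCoeff_ne_zero.2 hp0
        rw [Polynomial.leadingCoeff, hr, hp,
          Polynomial.ofFn_coeff_eq_val_of_lt w (Nat.lt_succ_self r)] at h3
        exact h3 h
      omega
    · omega
  omega

theorem mem_evalSubspace {v : PencilSpace F r} {x : Fˣ} :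
    v ∈ evalSubspace r x ↔ v.2.1 = x * v.1 ∧ polyEval (x : F) v.2.2 = 0 := by
  simp [evalSubspace, fstForm, sndForm, sub_eq_zero]

/-- A hyperplane through `a = b = 0` contains one of the subspaces `a = 0`, `b = 0`, or `b = x a`,
`w(x) = 0`. -/
theorem exists_ker_of_axis_le {f : Dual F (PencilSpace F r)}
    (h : axis F r ≤ LinearMap.ker f) :
    LinearMap.ker fstForm ≤ LinearMap.ker f ∨ LinearMap.ker sndForm ≤ LinearMap.ker f ∨
      ∃ x : Fˣ, evalSubspace r x ≤ LinearMap.ker f := by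
  set α := f (1, 0, 0) with hα
  set β := f (0, 1, 0) with hβ
  have key (v : PencilSpace F r) : f v = v.1 * α + v.2.1 * β := by
    have hv : v = v.1 • ((1, 0, 0) : PencilSpace F r) + v.2.1 • ((0, 1, 0) : PencilSpace F r) +
        (0, 0, v.2.2) := by
      refine Prod.ext ?_ (Prod.ext ?_ ?_) <;> simp
    have h0 : f (0, 0, v.2.2) = 0 := h (mem_axis.2 ⟨rfl, rfl⟩)
    conv_lhs => rw [hv]
    simp only [map_add, map_smul, h0, smul_eq_mul, add_zero, hα, hβ]
  by_cases hβ0 : β = 0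
  · left
    intro v hv
    rw [LinearMap.mem_ker, key, hβ0, mem_ker_fstForm.1 hv]
    simp
  by_cases hα0 : α = 0
  · right; left
    intro v hv
    rw [LinearMap.mem_ker, key, hα0, mem_ker_sndForm.1 hv]
    simp
  · right; right
    refine ⟨Units.mk0 (-α / β) (div_ne_zero (neg_ne_zero.2 hα0) hβ0), fun v hv => ?_⟩
    rw [LinearMap.mem_ker, key, (mem_evalSubspace.1 hv).1, Units.val_mk0]
    field_simp
    ring

variable [Fintype F]

/-- The multiplicities of the multiset removed from `r + 1` copies of the space: `a = 0` plus
`b = 0` minus `a = b = 0`, plus `w(0) = 0`, plus `w(∞) = 0`, plus all `b = x a`, `w(x) = 0`. -/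
noncomputable def baseMult (F : Type*) [Field F] [DecidableEq F] [Fintype F] (r : ℕ) :
    PencilSpace F r → ℤ :=
  subspaceInd (LinearMap.ker fstForm) + subspaceInd (LinearMap.ker sndForm) -
    subspaceInd (axis F r) + subspaceInd (LinearMap.ker (coordForm 0)) +
    subspaceInd (LinearMap.ker (coordForm (Fin.last r))) + ∑ x : Fˣ, subspaceInd (evalSubspace r x)

theorem baseMult_apply (v : PencilSpace F r) : baseMult F r v =
    (if v.1 = 0 then 1 else 0) + (if v.2.1 = 0 then 1 else 0) -
      (if v.1 = 0 ∧ v.2.1 = 0 then 1 else 0) + (if v.2.2 0 = 0 then 1 else 0) +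
      (if v.2.2 (Fin.last r) = 0 then 1 else 0) +
      ((Finset.univ.filter fun x : Fˣ =>
        v.2.1 = x * v.1 ∧ polyEval (x : F) v.2.2 = 0).card : ℤ) := by
  classical
  simp only [baseMult, Pi.add_apply, Pi.sub_apply, Finset.sum_apply, subspaceInd_eq_ite, mem_axis,
    mem_evalSubspace, mem_ker_fstForm, mem_ker_sndForm, mem_ker_coordForm, Finset.sum_boole]

/-- Off `a = b = 0`, the conditions `a = 0`, `b = 0` and `b = x a`, `x ∈ Fˣ`, exclude each other. -/
theorem pencil_part_le_one (v : PencilSpace F r) (hv : ¬(v.1 = 0 ∧ v.2.1 = 0)) :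
    (if v.1 = 0 then 1 else 0) + (if v.2.1 = 0 then 1 else 0) +
      (Finset.univ.filter fun x : Fˣ => v.2.1 = x * v.1 ∧ polyEval (x : F) v.2.2 = 0).card ≤ 1 := by
  by_cases ha : v.1 = 0
  · have hb : v.2.1 ≠ 0 := fun hb => hv ⟨ha, hb⟩
    simp [ha, hb]
  by_cases hb : v.2.1 = 0
  · simp [ha, hb]
  · simp only [ha, hb, if_false, zero_add]
    refine Finset.card_le_one.2 fun x hx y hy => Units.ext (mul_right_cancel₀ ha ?_)
    rw [← (Finset.mem_filter.1 hx).2.1, ← (Finset.mem_filter.1 hy).2.1]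

theorem baseMult_le (hr : 2 ≤ r) (v : PencilSpace F r) (hv : v ≠ 0) : baseMult F r v ≤ r + 1 := by
  rw [baseMult_apply]
  by_cases h : v.1 = 0 ∧ v.2.1 = 0
  · have hw : v.2.2 ≠ 0 := fun hw => hv (Prod.ext h.1 (Prod.ext h.2 hw))
    have := card_zeros_add_le v.2.2 hw
    simp only [h.1, h.2, mul_zero, true_and, if_true, and_self]
    zify at this
    linarith
  · have := pencil_part_le_one v h
    zify at this
    rw [if_neg h]
    have h1 : (if v.2.2 0 = 0 then 1 else 0 : ℤ) ≤ 1 := by split_ifs <;> simp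
    have h2 : (if v.2.2 (Fin.last r) = 0 then 1 else 0 : ℤ) ≤ 1 := by split_ifs <;> simp
    have : (2 : ℤ) ≤ r := by exact_mod_cast hr
    linarith

theorem baseMult_le_two (hr : 2 ≤ r) {l : Fˣ} {v : PencilSpace F r} (hv : v ≠ 0)
    (h : v ∈ ruling r (l : F)) : baseMult F r v ≤ 2 := by
  have hax := not_axis_of_mem_ruling hv h
  have := pencil_part_le_one v hax
  zify at this
  rw [baseMult_apply, if_neg hax, (ruling_coords hr h).1, (ruling_coords hr h).2]
  have h1 : (if (l : F) * v.1 = 0 then 1 else 0 : ℤ) +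
      (if (l : F) * v.2.1 = 0 then 1 else 0 : ℤ) ≤ 1 := by
    by_cases ha : v.1 = 0
    · have hb : v.2.1 ≠ 0 := fun hb => hax ⟨ha, hb⟩
      simp [ha, hb]
    · simp only [mul_eq_zero, l.ne_zero, ha, false_or, if_false, zero_add]
      split_ifs <;> simp
  linarith

/-- The condition `l₀ ∈ Λ → T = ∅` keeps the removed points off the removed lines. -/
theorem baseMult_add_removalMult_le (hr : 2 ≤ r) {Λ : Finset Fˣ} {l₀ : Fˣ} {T : Finset F}
    (hT : l₀ ∈ Λ → T = ∅) {v : PencilSpace F r} (hv : v ≠ 0) :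
    baseMult F r v + removalMult r Λ l₀ T v ≤ r + 1 := by
  simp only [removalMult, Pi.add_apply, Finset.sum_apply]
  by_cases h : ∃ l : Fˣ, v ∈ ruling r (l : F)
  · obtain ⟨l, hl⟩ := h
    have h1 := baseMult_le_two hr hv hl
    have h2 : ∑ i ∈ Λ, subspaceInd (ruling r (i : F)) v +
        ∑ y ∈ T, subspaceInd (rulingPoint r (l₀ : F) y) v ≤ 1 := by
      have hΛ := sum_subspaceInd_le_one Λ (fun i : Fˣ => ruling r (i : F)) v
        fun i _ j _ hi hj => Units.ext (ruling_inj hr hv hi hj)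
      have hT1 := sum_subspaceInd_le_one T (fun y => rulingPoint r (l₀ : F) y) v
        fun i _ j _ hi hj => rulingPoint_inj hv hi hj
      by_cases hl₀ : l = l₀ ∧ l₀ ∉ Λ
      · rw [Finset.sum_eq_zero (s := Λ), zero_add]
        · exact hT1
        · intro i hi
          refine subspaceInd_of_notMem fun hiv => hl₀.2 ?_
          rwa [← hl₀.1, ← Units.ext (ruling_inj hr hv hiv hl)]
      · rw [Finset.sum_eq_zero (s := T), add_zero]
        · exact hΛ
        · intro y hy
          refine subspaceInd_of_notMem fun hyv => hl₀ ⟨?_, fun hmem => ?_⟩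
          · exact Units.ext (ruling_inj hr hv hl (rulingPoint_le _ _ hyv))
          · simp [hT hmem] at hy
    have : (2 : ℤ) ≤ r := by exact_mod_cast hr
    linarith
  · rw [Finset.sum_eq_zero (s := Λ), Finset.sum_eq_zero (s := T), add_zero, add_zero]
    · exact baseMult_le hr v hv
    · exact fun y _ => subspaceInd_of_notMem fun hy => h ⟨l₀, rulingPoint_le _ _ hy⟩
    · exact fun l _ => subspaceInd_of_notMem fun hl => h ⟨l, hl⟩

end

/-! ### Counting the multiset and its hyperplane sections -/

theorem card_pencilSpace {F : Type*} [Fintype F] {r : ℕ} :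
    Nat.card (PencilSpace F r) = Fintype.card F ^ (r + 3) := by
  rw [Nat.card_prod, Nat.card_prod, Nat.card_fun, Nat.card_eq_fintype_card,
    Nat.card_eq_fintype_card, Fintype.card_fin]
  ring

section

variable {F : Type*} [Field F] {r : ℕ}

theorem fstForm_ne_zero : (fstForm : PencilSpace F r →ₗ[F] F) ≠ 0 := fun h =>
  one_ne_zero (LinearMap.congr_fun h ((1, 0, 0) : PencilSpace F r) : (1 : F) = 0)

theorem sndForm_ne_zero : (sndForm : PencilSpace F r →ₗ[F] F) ≠ 0 := fun h =>
  one_ne_zero (LinearMap.congr_fun h ((0, 1, 0) : PencilSpace F r) : (1 : F) = 0)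

theorem coordForm_ne_zero (i : Fin (r + 1)) : (coordForm i : PencilSpace F r →ₗ[F] F) ≠ 0 :=
  fun h => one_ne_zero
    (LinearMap.congr_fun h ((0, 0, fun _ => 1) : PencilSpace F r) : (1 : F) = 0)

variable [Fintype F]

theorem card_ker_mul {X : Type*} [AddCommGroup X] [Module F X] (φ : PencilSpace F r →ₗ[F] X)
    (h : Function.Surjective φ) :
    Nat.card (LinearMap.ker φ) * Nat.card X = Fintype.card F ^ (r + 3) := by
  rw [← card_pencilSpace (r := r), Submodule.card_eq_card_quotient_mul_card (LinearMap.ker φ),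
    Nat.card_congr (φ.quotKerEquivOfSurjective h).toEquiv]

theorem card_ker_form (φ : PencilSpace F r →ₗ[F] F) (h : φ ≠ 0) :
    Nat.card (LinearMap.ker φ) = Fintype.card F ^ (r + 2) := by
  have := card_ker_mul φ (LinearMap.surjective h)
  rw [Nat.card_eq_fintype_card (α := F), pow_succ] at this
  exact Nat.eq_of_mul_eq_mul_right Fintype.card_pos this

theorem card_ker_pair (φ : PencilSpace F r →ₗ[F] F × F) (h : Function.Surjective φ) :
    Nat.card (LinearMap.ker φ) = Fintype.card F ^ (r + 1) := by
  have := card_ker_mul φ h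
  rw [Nat.card_prod, Nat.card_eq_fintype_card (α := F), pow_succ, pow_succ, mul_assoc] at this
  exact Nat.eq_of_mul_eq_mul_right (Nat.mul_pos Fintype.card_pos Fintype.card_pos) this

theorem card_axis : Nat.card (axis F r) = Fintype.card F ^ (r + 1) :=
  card_ker_pair _ fun x => ⟨(x.1, x.2, 0), rfl⟩

theorem card_ruling (l : F) : Nat.card (ruling r l) = Fintype.card F ^ 2 := by
  have hinj : Function.Injective (rulingMap r l) := fun x y h => by
    have h1 : x.1 = y.1 := (Prod.ext_iff.1 h).1
    have h2 : x.2 = y.2 := (Prod.ext_iff.1 (Prod.ext_iff.1 h).2).1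
    exact Prod.ext h1 h2
  rw [ruling, ← Nat.card_congr (LinearEquiv.ofInjective _ hinj).toEquiv, Nat.card_prod,
    Nat.card_eq_fintype_card, sq]

theorem card_rulingPoint (l y : F) : Nat.card (rulingPoint r l y) = Fintype.card F ^ 1 := by
  have hne : rulingMap r l (1, y) ≠ 0 := fun h => one_ne_zero (congrArg Prod.fst h : (1 : F) = 0)
  rw [rulingPoint, Module.natCard_eq_pow_finrank (K := F), finrank_span_singleton hne,
    Nat.card_eq_fintype_card]

theorem sumWhere_removalMult_ne_zero (Λ : Finset Fˣ) (l₀ : Fˣ) (T : Finset F) :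
    sumWhere (fun v => v ≠ 0) (removalMult r Λ l₀ T) =
      Λ.card * ((Fintype.card F : ℤ) ^ 2 - 1) + T.card * ((Fintype.card F : ℤ) - 1) := by
  simp only [removalMult, map_add, map_sum, sumWhere_ne_zero_subspaceInd, card_ruling,
    card_rulingPoint, Finset.sum_const, nsmul_eq_mul]
  push_cast
  ring

theorem sumWhere_removalMult_le (Λ : Finset Fˣ) (l₀ : Fˣ) (T : Finset F)
    (f : Dual F (PencilSpace F r)) :
    sumWhere (fun v => f v ≠ 0) (removalMult r Λ l₀ T) ≤
      Λ.card * ((Fintype.card F : ℤ) ^ 2 - (Fintype.card F : ℤ)) +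
        T.card * ((Fintype.card F : ℤ) - 1) := by
  classical
  simp only [removalMult, map_add, map_sum]
  refine add_le_add ?_ ?_
  · refine (Finset.sum_le_card_nsmul _ _ _ fun (l : Fˣ) _ =>
      sumWhere_subspaceInd_le (j := 1) f (card_ruling (l : F))).trans_eq ?_
    rw [nsmul_eq_mul, pow_one]
  · refine (Finset.sum_le_card_nsmul _ _ _ fun y _ =>
      sumWhere_subspaceInd_le (j := 0) f (card_rulingPoint (l₀ : F) y)).trans_eq ?_
    rw [nsmul_eq_mul, pow_zero, zero_add, pow_one]

variable [DecidableEq F]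

theorem card_evalSubspace (x : Fˣ) : Nat.card (evalSubspace r x) = Fintype.card F ^ (r + 1) := by
  refine card_ker_pair _ fun y => ⟨(0, y.1, Pi.single 0 y.2), Prod.ext ?_ ?_⟩
  · simp [fstForm, sndForm]
  · simp [polyEval, Polynomial.ofFn_eq_sum_monomial, Polynomial.leval, Polynomial.eval_finsetSum,
      Pi.single_apply, Polynomial.eval_monomial]

theorem card_units_cast : (Fintype.card Fˣ : ℤ) = (Fintype.card F : ℤ) - 1 := by
  have h0 : 1 ≤ Fintype.card F := Fintype.card_pos
  rw [Fintype.card_units, Nat.cast_sub h0, Nat.cast_one]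

theorem sumWhere_baseMult_ne_zero : sumWhere (fun v => v ≠ 0) (baseMult F r) =
    4 * ((Fintype.card F : ℤ) ^ (r + 2) - 1) +
      ((Fintype.card F : ℤ) - 2) * ((Fintype.card F : ℤ) ^ (r + 1) - 1) := by
  simp only [baseMult, map_add, map_sub, map_sum, sumWhere_ne_zero_subspaceInd, card_evalSubspace,
    card_axis, card_ker_form _ fstForm_ne_zero, card_ker_form _ sndForm_ne_zero,
    card_ker_form _ (coordForm_ne_zero _), Finset.sum_const, Finset.card_univ, nsmul_eq_mul,
    card_units_cast]
  push_cast
  ring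

/-- The bound is the one for four hyperplanes and `q - 2` subspaces of codimension two. -/
theorem sumWhere_baseMult_le (f : Dual F (PencilSpace F r)) :
    sumWhere (fun v => f v ≠ 0) (baseMult F r) ≤
    4 * ((Fintype.card F : ℤ) ^ (r + 2) - (Fintype.card F : ℤ) ^ (r + 1)) +
      ((Fintype.card F : ℤ) - 2) *
        ((Fintype.card F : ℤ) ^ (r + 1) - (Fintype.card F : ℤ) ^ r) := by
  have h1 := sumWhere_subspaceInd_le f (card_ker_form (r := r) _ fstForm_ne_zero)
  have h2 := sumWhere_subspaceInd_le f (card_ker_form (r := r) _ sndForm_ne_zero)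
  have h3 := sumWhere_subspaceInd_le f (card_ker_form (r := r) _ (coordForm_ne_zero 0))
  have h4 := sumWhere_subspaceInd_le f (card_ker_form (r := r) _ (coordForm_ne_zero (Fin.last r)))
  have h5 (x : Fˣ) := sumWhere_subspaceInd_le f (card_evalSubspace (r := r) x)
  have h6 := Finset.sum_le_sum fun x (_ : x ∈ Finset.univ) => h5 x
  have hq : (1 : ℤ) ≤ Fintype.card F := by exact_mod_cast Fintype.card_pos
  -- Losing a hyperplane outweighs giving back a codimension-two subspace.
  have hmono : (0 : ℤ) ≤ ((Fintype.card F : ℤ) ^ (r + 2) - (Fintype.card F : ℤ) ^ (r + 1)) -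
      ((Fintype.card F : ℤ) ^ (r + 1) - (Fintype.card F : ℤ) ^ r) := by
    have : ((Fintype.card F : ℤ) ^ (r + 2) - (Fintype.card F : ℤ) ^ (r + 1)) -
      ((Fintype.card F : ℤ) ^ (r + 1) - (Fintype.card F : ℤ) ^ r) =
        (Fintype.card F : ℤ) ^ r * ((Fintype.card F : ℤ) - 1) ^ 2 := by ring
    rw [this]
    positivity
  simp only [Finset.sum_const, Finset.card_univ, nsmul_eq_mul, card_units_cast] at h6
  simp only [baseMult, map_add, map_sub, map_sum]
  by_cases h : axis F r ≤ LinearMap.ker f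
  · rw [sumWhere_subspaceInd_of_le_ker h]
    rcases exists_ker_of_axis_le h with h0 | h0 | ⟨x, h0⟩
    · rw [sumWhere_subspaceInd_of_le_ker h0]
      linarith
    · rw [sumWhere_subspaceInd_of_le_ker h0]
      linarith
    · have h7 := Finset.sum_le_sum fun y (_ : y ∈ Finset.univ.erase x) => h5 y
      simp only [Finset.sum_const, Finset.card_erase_of_mem (Finset.mem_univ x), Finset.card_univ,
        nsmul_eq_mul, Nat.cast_sub (Nat.one_le_iff_ne_zero.2 (Fintype.card_ne_zero (α := Fˣ))),
        card_units_cast, Nat.cast_one] at h7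
      rw [← Finset.sum_erase_add _ _ (Finset.mem_univ x), sumWhere_subspaceInd_of_le_ker h0]
      linarith
  · have h7 := sumWhere_subspaceInd_of_not_le_ker (card_axis (F := F) (r := r)) h
    rw [h7]
    linarith

/-- Since `a q + b ≤ (q - 1) q`, among the `q - 1` lines there are `a` of them, and one more if
`b ≠ 0`, on which `b` points can be chosen. -/
theorem exists_finsets_of_le (F : Type*) [Field F] [Fintype F] {a b : ℕ}
    (hb : b < Fintype.card F) (h : a * Fintype.card F + b ≤ Fintype.card F ^ 2 - Fintype.card F) :
    ∃ (Λ : Finset Fˣ) (l₀ : Fˣ) (T : Finset F), Λ.card = a ∧ T.card = b ∧ (l₀ ∈ Λ → T = ∅) := by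
  classical
  have hq : 0 < Fintype.card F := Fintype.card_pos
  have hsq : Fintype.card F ^ 2 - Fintype.card F = (Fintype.card F - 1) * Fintype.card F := by
    rw [Nat.sub_one_mul, sq]
  rw [hsq] at h
  obtain ⟨T, -, hT⟩ := Finset.exists_subset_card_eq (s := (Finset.univ : Finset F)) (n := b)
    (by rw [Finset.card_univ]; omega)
  have ha : a ≤ Fintype.card F - 1 := Nat.le_of_mul_le_mul_right (by omega) hq
  rw [← Fintype.card_units] at ha
  obtain ⟨Λ, -, hΛ⟩ := Finset.exists_subset_card_eq (s := (Finset.univ : Finset Fˣ)) (n := a)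
    (by rwa [Finset.card_univ])
  by_cases hb0 : b = 0
  · exact ⟨Λ, 1, T, hΛ, hT, fun _ => Finset.card_eq_zero.1 (hT.trans hb0)⟩
  · have hlt : Λ.card < Fintype.card Fˣ := by
      rw [hΛ, Fintype.card_units]
      exact lt_of_mul_lt_mul_right (by omega) (Nat.zero_le (Fintype.card F))
    obtain ⟨l₀, hl₀⟩ := Finset.exists_mem_notMem_of_card_lt_card (s := Λ) (t := Finset.univ)
      (by rwa [Finset.card_univ])
    exact ⟨Λ, l₀, T, hΛ, hT, fun hmem => absurd hmem hl₀.2⟩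

/-- The Griesmer code of dimension `r + 3` whose distance is `e` below the upper end. -/
theorem exists_isLinearCode_griesmer {q d e : ℕ} (hF : Fintype.card F = q) (hq : 5 ≤ q)
    (hr : 2 ≤ r) (he : e ≤ q ^ 2 - q)
    (hd : d + e + 5 * q ^ (r + 1) = (r + 1) * q ^ (r + 2) + 2 * q ^ r) :
    ∃ C : Submodule F (Fin (griesmerBound q (r + 3) d) → F), IsLinearCode C (r + 3) d := by
  classical
  obtain ⟨Λ, l₀, T, hΛ, hT, hΛT⟩ := exists_finsets_of_le F (a := e / q) (b := e % q)
    (by rw [hF]; exact Nat.mod_lt _ (by omega)) (by rw [hF, mul_comm, Nat.div_add_mod]; exact he)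
  have he' : (e : ℤ) = q * Λ.card + T.card := by
    rw [hΛ, hT]
    exact_mod_cast (Nat.div_add_mod e q).symm
  have hdz : (d : ℤ) + e + 5 * q ^ (r + 1) = (r + 1) * q ^ (r + 2) + 2 * q ^ r := by
    exact_mod_cast hd
  have hrank : finrank F (PencilSpace F r) = r + 3 := by
    simp [PencilSpace]
    ring
  rw [← hrank]
  have hmult (v : PencilSpace F r) :
      (((r : ℤ) + 1) • subspaceInd (⊤ : Submodule F (PencilSpace F r)) - baseMult F r -
        removalMult r Λ l₀ T) v = r + 1 - (baseMult F r v + removalMult r Λ l₀ T v) := by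
    rw [Pi.sub_apply, Pi.sub_apply, Pi.smul_apply, subspaceInd_of_mem Submodule.mem_top]
    simp [sub_sub]
  have htop : Nat.card (⊤ : Submodule F (PencilSpace F r)) = Fintype.card F ^ (r + 3) := by
    rw [← card_pencilSpace (F := F) (r := r)]
    exact Nat.card_congr Submodule.topEquiv.toEquiv
  refine exists_isLinearCode_of_multiplicity
    (((r : ℤ) + 1) • subspaceInd (⊤ : Submodule F (PencilSpace F r)) - baseMult F r -
      removalMult r Λ l₀ T) ?_ ?_ ?_ (by omega) ?_ ?_
  · intro c v hc
    simp [baseMult, removalMult, subspaceInd_smul _ hc]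
  · intro v hv
    rw [hmult, sub_nonneg]
    exact baseMult_add_removalMult_le hr hΛT hv
  · have h1 : 5 ^ 2 * q ^ r ≤ q ^ (r + 2) := by
      rw [pow_add, mul_comm]
      exact Nat.mul_le_mul_left _ (Nat.pow_le_pow_left hq 2)
    have h2 : q ^ 2 ≤ q ^ r := Nat.pow_le_pow_right (by omega) hr
    have h3 : 5 * q ^ (r + 1) ≤ q ^ (r + 2) := by
      rw [pow_succ q (r + 1), mul_comm]
      exact Nat.mul_le_mul_left _ hq
    have h4 : 3 * q ^ (r + 2) ≤ (r + 1) * q ^ (r + 2) := Nat.mul_le_mul_right _ (by omega)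
    have h5 : 0 < q ^ r := by positivity
    omega
  · rw [← sumWhere_apply, map_sub, map_sub, map_zsmul, sumWhere_ne_zero_subspaceInd, htop,
      sumWhere_baseMult_ne_zero, sumWhere_removalMult_ne_zero, hF, hrank]
    have hq2 : ((q - 2 : ℕ) : ℤ) = q - 2 := by omega
    have hdig : d + ∑ j ∈ Finset.range (r + 2), defectDigit q r e j * q ^ j =
        (r + 1) * q ^ (r + 2) := by
      have := sum_defectDigit_mul (q := q) (e := e) hr fun j => (q : ℤ) ^ j
      zify
      rw [this, hq2, ← hΛ, ← hT]
      linear_combination hdz - he'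
    have hg := le_griesmerBound_of_digits (defectDigit q r e) (by omega)
      (defectDigit_lt hq he) hdig
    rw [sum_defectDigit_mul (q := q) (e := e) hr fun j => (q : ℤ) ^ (j + 1) - 1, hq2, ← hΛ,
      ← hT] at hg
    refine le_trans (le_of_eq ?_) hg
    push_cast
    rw [smul_eq_mul]
    ring
  · intro f hf
    have h1 := sumWhere_baseMult_le (r := r) f
    have h2 := sumWhere_removalMult_le (r := r) Λ l₀ T f
    have h3 : ¬(⊤ : Submodule F (PencilSpace F r)) ≤ LinearMap.ker f := fun h =>
      hf (LinearMap.ext fun v => h Submodule.mem_top)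
    rw [← sumWhere_apply, map_sub, map_sub, map_zsmul,
      sumWhere_subspaceInd_of_not_le_ker (j := r + 2) htop h3, hF, smul_eq_mul]
    rw [hF] at h1 h2
    have h4 : (d : ℤ) = (r + 1) * q ^ (r + 2) + 2 * q ^ r - 5 * q ^ (r + 1) -
      (q * Λ.card + T.card) := by linarith
    rw [h4]
    refine le_trans (le_of_eq ?_) (sub_le_sub (sub_le_sub_left h1 _) h2)
    ring

end

theorem theorem2 (k q d : ℕ) (F : Type*) [Field F] [Fintype F] [DecidableEq F]
    (hF : Fintype.card F = q) (hk : 5 ≤ k) (hq : max 5 (k - 2) ≤ q)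
    (hd_lower : ((k : ℤ) - 2) * (q : ℤ) ^ (k - 1) - 5 * (q : ℤ) ^ (k - 2)
        + 2 * (q : ℤ) ^ (k - 3) - (q : ℤ) ^ 2 + (q : ℤ) ≤ (d : ℤ))
    (hd_upper : (d : ℤ) ≤ ((k : ℤ) - 2) * (q : ℤ) ^ (k - 1) - 5 * (q : ℤ) ^ (k - 2)
        + 2 * (q : ℤ) ^ (k - 3)) :
    ∃ C : Submodule F (Fin (griesmerBound q k d) → F), IsLinearCode C k d := by
  obtain ⟨r, rfl⟩ := Nat.exists_eq_add_of_le' (show 3 ≤ k by omega)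
  rw [show r + 3 - 1 = r + 2 by omega, show r + 3 - 2 = r + 1 by omega,
    show r + 3 - 3 = r by omega] at hd_lower hd_upper
  push_cast at hd_lower hd_upper
  obtain ⟨e, he⟩ := Int.le.dest hd_upper
  have hqq : q ≤ q ^ 2 := Nat.le_self_pow two_ne_zero q
  refine exists_isLinearCode_griesmer (e := e) hF (le_of_max_le_left hq) (by omega) ?_ ?_
  · zify [hqq]
    linarith
  · zify
    linear_combination he
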